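/- For a sequence $c=(c_k)_{k\ge 0}$ write $H_n(c_k)=\det\big(c_{i+j}\big)_{0\le i,j\le n}$. Let $B_k$ be the Bernoulli numbers, $\sum_{k\ge 0}B_k\frac{t^k}{k!}=\frac{t}{e^t-1}$, and let $\mathcal H_n=\sum_{j=1}^n\frac1j$ be the harmonic numbers (so $\mathcal H_0=0$). (a) For all $n\ge 0$, \[ H_n\big((2k+1)B_{2k}\big)=\frac{(-1)^n(2n+2)!}{n!\,(n+1)!^3}\cdot\big(\mathcal H_n+\mathcal H_{n+1}\big)\cdot H_n\big((2k+3)B_{2k+2}\big). \] (b) Let $L$ be the linear functional on $\mathbb Q[y]$ with $L(y^k)=(2k+3)B_{2k+2}$ for all $k\ge 0$. There is exactly one sequence $(P_n)_{n\ge 0}$ in $\mathbb Q[y]$ such that each $P_n$ is monic of degree $n$, $L(P_mP_n)=0$ for $m\ne n$, and $L(P_n^2)\ne 0$ for all $n$. It satisfies $P_0(y)=1$, $P_1(y)=y+s_0$ and \[ P_{n+1}(y)=(y+s_n)P_n(y)-t_nP_{n-1}(y)\qquad(n\ge 1), \] where \[ s_n=\frac{(n+1)^2(2n^2+4n+1)}{(2n+1)(2n+3)}\quad(n\ge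 0),\qquad t_n=\frac{n^3(n+1)^3}{4(2n+1)^2}\quad(n\ge 1). \] -/

import Mathlib

open scoped Nat

/-- The Hankel determinant `H_n(c) = det (c_{i+j})_{0 ≤ i, j ≤ n}`; the matrix has size `n + 1`. -/
def hankelDet {R : Type*} [CommRing R] (c : ℕ → R) (n : ℕ) : R :=
  Matrix.det (Matrix.of fun i j : Fin (n + 1) => c ((i : ℕ) + (j : ℕ)))

/-- The linear functional `L` on polynomials determined by `L(x^k) = c_k`. -/
noncomputable def momentFunctional {R : Type*} [CommRing R] (c : ℕ → R) :
    Polynomial R →ₗ[R] R :=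
  Polynomial.lsum fun k => LinearMap.toSpanSingleton R R (c k)

theorem momentFunctional_X_pow {R : Type*} [CommRing R] (c : ℕ → R) (k : ℕ) :
    momentFunctional c (Polynomial.X ^ k) = c k := by
  simp [momentFunctional, Polynomial.X_pow_eq_monomial, Polynomial.lsum_apply]

/-- `P_0, P_1, …` are monic orthogonal polynomials with respect to the sequence `c`: each `P_n` is
monic of degree `n`, and `L(P_m P_n) = ζ_n δ_{m,n}` with every `ζ_n` nonzero. -/
structure IsMonicOrthogonal {R : Type*} [CommRing R] (c : ℕ → R) (P : ℕ → Polynomial R) :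
    Prop where
  monic : ∀ n, (P n).Monic
  natDegree_eq : ∀ n, (P n).natDegree = n
  orthogonal : ∀ m n, m ≠ n → momentFunctional c (P m * P n) = 0
  norm_ne_zero : ∀ n, momentFunctional c (P n * P n) ≠ 0

/-! Let L and M have moments (2k+3)B_{2k+2} and (2k+1)B_{2k}, so M(y f) = L(f). The Bernoulli
functional sends F(x+1) - F(x) to F'(0), so an explicit antidifference evaluates L on the products
∏(j² - y). In this basis P_n = `wilsonPoly n` has hypergeometric coefficients: ratios of
neighbouring coefficients give the three-term recurrence, and a telescoping sum gives L(P_n) = 0 for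
n ≥ 1. Favard's argument then yields orthogonality with nonzero norms ζ_{n+1} = t_{n+1} ζ_n, hence
(b).

For (a), a Hankel determinant is a product of norms. With μ_n = M(P_n), the polynomials P_{n+1} -
(μ_{n+1}/μ_n) P_n are orthogonal for M, with norms -(μ_{n+1}/μ_n) ζ_n. The product telescopes, so
the two determinants have quotient (-1)^n μ_n / ζ_n. Finally μ solves the three-term recurrence at y
= 0, which determines its harmonic-number closed form. -/

/-! ### Orthogonal polynomials for a general moment sequence -/

open Polynomial in
theorem momentFunctional_C_mul {R : Type*} [CommRing R] (c : ℕ → R) (a : R) (p : R[X]) :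
    momentFunctional c (C a * p) = a * momentFunctional c p := by
  rw [C_mul', map_smul, smul_eq_mul]

open Polynomial in
theorem momentFunctional_mul_eq_sum {R : Type*} [CommRing R] (c : ℕ → R) {p : R[X]} {n : ℕ}
    (hp : p.natDegree < n) (q : R[X]) :
    momentFunctional c (p * q) =
      ∑ i ∈ Finset.range n, p.coeff i * momentFunctional c (X ^ i * q) := by
  conv_lhs => rw [p.as_sum_range' n hp]
  rw [Finset.sum_mul, map_sum]
  refine Finset.sum_congr rfl fun i _ => ?_
  rw [← C_mul_X_pow_eq_monomial, mul_assoc, momentFunctional_C_mul]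

open Polynomial in
/-- If `q` is annihilated by all powers below `n`, only the degree `n` coefficient of a polynomial
of degree at most `n` contributes to its pairing with `q`. -/
theorem momentFunctional_mul_of_orthogonal {R : Type*} [CommRing R] (c : ℕ → R) {q : R[X]} {n : ℕ}
    (hq : ∀ j < n, momentFunctional c (X ^ j * q) = 0) {p : R[X]} (hp : p.natDegree ≤ n) :
    momentFunctional c (p * q) = p.coeff n * momentFunctional c (X ^ n * q) := by
  rw [momentFunctional_mul_eq_sum c (Nat.lt_succ_of_le hp), Finset.sum_range_succ,
    Finset.sum_eq_zero, zero_add]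
  intro i hi
  rw [hq i (Finset.mem_range.1 hi), mul_zero]

-- The coefficient matrix of Q is unit upper triangular, and multiplying the Hankel matrix by it
-- gives the entries L(x^i Q_j), lower triangular by orthogonality.
open Polynomial in
theorem hankelDet_eq_prod {R : Type*} [CommRing R] (c : ℕ → R) (Q : ℕ → R[X])
    (hm : ∀ n, (Q n).Monic) (hd : ∀ n, (Q n).natDegree = n)
    (ho : ∀ n, ∀ j < n, momentFunctional c (X ^ j * Q n) = 0) (n : ℕ) :
    hankelDet c n = ∏ k ∈ Finset.range (n + 1), momentFunctional c (X ^ k * Q k) := by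
  set H : Matrix (Fin (n + 1)) (Fin (n + 1)) R :=
    Matrix.of fun i j : Fin (n + 1) => c ((i : ℕ) + (j : ℕ)) with hH
  set A : Matrix (Fin (n + 1)) (Fin (n + 1)) R := Matrix.of fun i j => (Q j).coeff i with hA
  have hAdet : A.det = 1 := by
    rw [Matrix.det_of_isUpperTriangular]
    · refine Finset.prod_eq_one fun i _ => ?_
      have := (hm i).coeff_natDegree
      rw [hd] at this
      simpa [hA] using this
    · intro i j hij
      have hij' : j < i := hij
      simp only [hA, Matrix.of_apply]
      exact coeff_eq_zero_of_natDegree_lt (by rw [hd]; exact hij')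
  have hmul : ∀ i j, (H * A) i j = momentFunctional c (X ^ (i : ℕ) * Q j) := by
    intro i j
    rw [mul_comm, momentFunctional_mul_eq_sum c (n := n + 1) (by rw [hd]; exact j.2),
      Matrix.mul_apply, ← Fin.sum_univ_eq_sum_range
        (fun k => (Q j).coeff k * momentFunctional c (X ^ k * X ^ (i : ℕ)))]
    refine Finset.sum_congr rfl fun k _ => ?_
    rw [← pow_add, momentFunctional_X_pow]
    simp [hH, hA, add_comm, mul_comm]
  have hdet : (H * A).det = ∏ i : Fin (n + 1), (H * A) i i := by
    refine Matrix.det_of_isLowerTriangular _ ?_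
    intro i j hij
    rw [hmul]
    exact ho _ _ hij
  rw [Matrix.det_mul, hAdet, mul_one] at hdet
  rw [hankelDet, ← hH, hdet,
    ← Fin.prod_univ_eq_prod_range (fun k => momentFunctional c (X ^ k * Q k))]
  exact Finset.prod_congr rfl fun i _ => hmul i i

open Polynomial in
theorem IsMonicOrthogonal.of_orthogonal_X_pow {R : Type*} [CommRing R] {c : ℕ → R} {Q : ℕ → R[X]}
    (hm : ∀ n, (Q n).Monic) (hd : ∀ n, (Q n).natDegree = n)
    (ho : ∀ n, ∀ j < n, momentFunctional c (X ^ j * Q n) = 0)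
    (hn : ∀ n, momentFunctional c (X ^ n * Q n) ≠ 0) : IsMonicOrthogonal c Q := by
  have key : ∀ m n, m < n → momentFunctional c (Q m * Q n) = 0 := by
    intro m n h
    rw [momentFunctional_mul_of_orthogonal c (ho n) (by rw [hd]; exact h.le),
      coeff_eq_zero_of_natDegree_lt (by rw [hd]; exact h), zero_mul]
  refine ⟨hm, hd, fun m n h => ?_, fun n => ?_⟩
  · rcases lt_or_gt_of_ne h with h | h
    · exact key m n h
    · rw [mul_comm]; exact key n m h
  · rw [momentFunctional_mul_of_orthogonal c (ho n) (hd n).le]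
    have := (hm n).coeff_natDegree
    rw [hd] at this
    rw [this, one_mul]
    exact hn n

-- If P_n - Q_n is nonzero of degree d < n, its pairing with Q_d = P_d vanishes, yet equals its
-- leading coefficient times a nonzero norm.
open Polynomial in
theorem IsMonicOrthogonal.eq_of_orthogonal_X_pow {R : Type*} [CommRing R] [IsDomain R] {c : ℕ → R}
    {P Q : ℕ → R[X]} (hP : IsMonicOrthogonal c P) (hQ : IsMonicOrthogonal c Q)
    (ho : ∀ n, ∀ j < n, momentFunctional c (X ^ j * Q n) = 0)
    (hn : ∀ n, momentFunctional c (X ^ n * Q n) ≠ 0) : P = Q := by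
  funext n
  induction n using Nat.strong_induction_on with
  | _ n ih =>
    by_contra hne
    have hD : P n - Q n ≠ 0 := sub_ne_zero.2 hne
    have hlt : (P n - Q n).natDegree < n := by
      have h := degree_sub_lt_left (p := P n) (q := Q n)
        (by rw [degree_eq_natDegree (hP.monic n).ne_zero, degree_eq_natDegree (hQ.monic n).ne_zero,
          hP.natDegree_eq, hQ.natDegree_eq]) (hP.monic n).ne_zero
        (by rw [(hP.monic n).leadingCoeff, (hQ.monic n).leadingCoeff])
      have := natDegree_lt_natDegree hD h
      rwa [hP.natDegree_eq] at this
    have h0 : momentFunctional c ((P n - Q n) * Q (P n - Q n).natDegree) = 0 := by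
      rw [sub_mul, map_sub, hQ.orthogonal _ _ hlt.ne', ← ih _ hlt, hP.orthogonal _ _ hlt.ne',
        sub_zero]
    rw [momentFunctional_mul_of_orthogonal c (ho _) le_rfl] at h0
    exact (mul_ne_zero (leadingCoeff_ne_zero.2 hD) (hn _)) h0

open Polynomial in
theorem monic_natDegree_of_three_term {R : Type*} [CommRing R] [Nontrivial R] {P : ℕ → R[X]}
    {s t : ℕ → R} (h0 : P 0 = 1) (h1 : P 1 = X + C (s 0))
    (hrec : ∀ n, P (n + 2) = (X + C (s (n + 1))) * P (n + 1) - C (t (n + 1)) * P n) (n : ℕ) :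
    (P n).Monic ∧ (P n).natDegree = n := by
  induction n using Nat.twoStepInduction with
  | zero => simp [h0]
  | one => rw [h1]; exact ⟨monic_X_add_C _, natDegree_X_add_C _⟩
  | more n ih0 ih1 =>
    have hM : ((X + C (s (n + 1))) * P (n + 1)).Monic := (monic_X_add_C _).mul ih1.1
    have hN : ((X + C (s (n + 1))) * P (n + 1)).natDegree = n + 2 := by
      rw [(monic_X_add_C _).natDegree_mul ih1.1, natDegree_X_add_C, ih1.2]; ring
    have hlt : (C (t (n + 1)) * P n).natDegree < n + 2 :=
      lt_of_le_of_lt (natDegree_C_mul_le _ _) (by rw [ih0.2]; omega)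
    rw [hrec]
    constructor
    · refine hM.sub_of_left ?_
      refine degree_lt_degree ?_
      rwa [hN]
    · rw [natDegree_sub_eq_left_of_natDegree_lt (by rwa [hN]), hN]

open Polynomial in
/-- One direction of Favard's theorem. -/
theorem momentFunctional_three_term {R : Type*} [CommRing R] {c : ℕ → R} {P : ℕ → R[X]}
    {s t : ℕ → R}
    (hrec : ∀ n, P (n + 2) = (X + C (s (n + 1))) * P (n + 1) - C (t (n + 1)) * P n)
    (hP : ∀ n, momentFunctional c (P (n + 1)) = 0) (m : ℕ) :
    (∀ n, m < n → momentFunctional c (X ^ m * P n) = 0) ∧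
      momentFunctional c (X ^ (m + 1) * P (m + 1)) =
        t (m + 1) * momentFunctional c (X ^ m * P m) := by
  -- The recurrence solved for X * P (n + 1), trading a power of X for a change of index.
  have step : ∀ m n, momentFunctional c (X ^ (m + 1) * P (n + 1)) =
      momentFunctional c (X ^ m * P (n + 2)) - s (n + 1) * momentFunctional c (X ^ m * P (n + 1))
        + t (n + 1) * momentFunctional c (X ^ m * P n) := by
    intro m n
    rw [← momentFunctional_C_mul, ← momentFunctional_C_mul, ← map_sub, ← map_add, hrec]
    congr 1
    ring
  have hz : ∀ m n, m < n → momentFunctional c (X ^ m * P n) = 0 := by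
    intro m
    induction m with
    | zero =>
      rintro (_ | n) h
      · omega
      · simpa using hP n
    | succ m ih =>
      rintro (_ | n) h
      · omega
      · rw [step, ih _ (by omega), ih _ (by omega), ih _ (by omega)]
        ring
  refine ⟨hz m, ?_⟩
  rw [step, hz _ _ (by omega), hz _ _ (by omega)]
  ring

/-! ### The Bernoulli functional -/

-- On monomials this is the identity that ∑_{k<n} C(n,k) B_k is 1 for n = 1 and 0 otherwise.
open Polynomial in
theorem momentFunctional_bernoulli_shift (F : ℚ[X]) :
    momentFunctional _root_.bernoulli (F.comp (X + 1) - F) = (derivative F).eval 0 := by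
  induction F using Polynomial.induction_on' with
  | add p q hp hq =>
    rw [add_comp, derivative_add, eval_add, ← hp, ← hq, ← map_add]
    congr 1
    ring
  | monomial n a =>
    rw [← C_mul_X_pow_eq_monomial, mul_comp, C_comp, pow_comp, X_comp, ← mul_sub,
      momentFunctional_C_mul, derivative_C_mul, eval_mul, eval_C]
    congr 1
    have h : (X + 1 : ℚ[X]) ^ n - X ^ n =
        ∑ k ∈ Finset.range n, C (n.choose k : ℚ) * X ^ k := by
      rw [add_pow, Finset.sum_range_succ]
      simp [mul_comm]
    rw [h, map_sum]
    simp only [momentFunctional_C_mul, momentFunctional_X_pow]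
    rw [_root_.sum_bernoulli]
    rcases n with _ | _ | n <;> simp

open Polynomial in
theorem momentFunctional_eq_bernoulli (f : ℚ[X]) :
    momentFunctional (fun k : ℕ => (2 * (k : ℚ) + 3) * _root_.bernoulli (2 * k + 2)) f =
      momentFunctional _root_.bernoulli (derivative (X ^ 3 * f.comp (X ^ 2))) := by
  induction f using Polynomial.induction_on' with
  | add p q hp hq => rw [map_add, hp, hq, add_comp, mul_add, derivative_add, map_add]
  | monomial n a =>
    have h : X ^ 3 * (C a * X ^ n : ℚ[X]).comp (X ^ 2) = C a * X ^ (2 * n + 3) := by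
      simp only [mul_comp, C_comp, pow_comp, X_comp]
      ring
    rw [← C_mul_X_pow_eq_monomial, h, momentFunctional_C_mul, derivative_C_mul,
      momentFunctional_C_mul, momentFunctional_X_pow, derivative_X_pow, momentFunctional_C_mul,
      momentFunctional_X_pow]
    push_cast
    rfl

/-! ### Central factorials and their moments -/

open Polynomial in
/-- The polynomial `∏_{j=1}^k (j² - y)`. -/
noncomputable def centralFactorial (k : ℕ) : ℚ[X] :=
  ∏ j ∈ Finset.range k, (C (((j : ℚ) + 1) ^ 2) - X)

open Polynomial in
theorem centralFactorial_succ (k : ℕ) :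
    centralFactorial (k + 1) = centralFactorial k * (C (((k : ℚ) + 1) ^ 2) - X) :=
  Finset.prod_range_succ _ _

open Polynomial in
theorem X_mul_centralFactorial (k : ℕ) :
    X * centralFactorial k =
      C (((k : ℚ) + 1) ^ 2) * centralFactorial k - centralFactorial (k + 1) := by
  rw [centralFactorial_succ]; ring

open Polynomial in
theorem eval_zero_centralFactorial (k : ℕ) : (centralFactorial k).eval 0 = (k ! : ℚ) ^ 2 := by
  induction k with
  | zero => simp [centralFactorial]
  | succ k ih =>
    rw [centralFactorial_succ, eval_mul, ih, Nat.factorial_succ]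
    simp
    ring

-- Factor j² - x² = (j - x)(j + x): the shift moves both windows of linear factors by one, so only
-- the end factors change.
open Polynomial in
theorem centralFactorial_comp_shift (k : ℕ) :
    (centralFactorial k).comp ((X + 1) ^ 2) * (C (k : ℚ) - X) * (X + 1) =
      -X * (centralFactorial k).comp (X ^ 2) * (C (k : ℚ) + 1 + X) := by
  induction k with
  | zero => simp [centralFactorial, add_comm]
  | succ k ih =>
    rw [centralFactorial_succ]
    simp only [mul_comp, sub_comp, X_comp, Nat.cast_succ, C_add, C_pow, C_1] at ih ⊢
    simp only [add_comp, pow_comp, C_comp, one_comp]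
    linear_combination (C (k : ℚ) + 2 + X) * (C (k : ℚ) + 1 - X) * ih

open Polynomial in
theorem momentFunctional_centralFactorial (k : ℕ) :
    momentFunctional (fun k : ℕ => (2 * (k : ℚ) + 3) * _root_.bernoulli (2 * k + 2)) (centralFactorial k) =
      (k ! : ℚ) * ((k + 1)! : ℚ) / (k + 2) := by
  have hk : (k : ℚ) + 2 ≠ 0 := by positivity
  set ψ := (centralFactorial k).comp (X ^ 2) with hψ
  -- Chosen so that X² R is an antidifference of X³ ψ: after the shift rule, (x+1)(x+k+1) -
  -- (x-1)(x-k-1) = 2(k+2)x.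
  set R : ℚ[X] := C (1 / (2 * ((k : ℚ) + 2))) * (X - 1) * (X - C (k : ℚ) - 1) * ψ with hR
  have hΔ : X ^ 3 * ψ = (X ^ 2 * R).comp (X + 1) - X ^ 2 * R := by
    have hs := centralFactorial_comp_shift k
    have hψ' : ψ.comp (X + 1) = (centralFactorial k).comp ((X + 1) ^ 2) := by
      rw [hψ, comp_assoc]; simp
    have hc : C (1 / (2 * ((k : ℚ) + 2))) * (2 * (C (k : ℚ) + 2)) = 1 := by
      have : (2 * (C (k : ℚ) + 2) : ℚ[X]) = C (2 * ((k : ℚ) + 2)) := by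
        rw [C_mul, C_add]; rfl
      rw [this, ← C_mul, one_div, inv_mul_cancel₀ (by positivity), C_1]
    rw [← hψ] at hs
    simp only [hR, mul_comp, pow_comp, sub_comp, X_comp, C_comp, one_comp, hψ']
    linear_combination C (1 / (2 * ((k : ℚ) + 2))) * X * (X + 1) * hs - X ^ 3 * ψ * hc
  have hd : derivative (X ^ 3 * ψ) =
      (derivative (X ^ 2 * R)).comp (X + 1) - derivative (X ^ 2 * R) := by
    rw [hΔ, derivative_sub, derivative_comp]; simp
  rw [momentFunctional_eq_bernoulli, ← hψ, hd, momentFunctional_bernoulli_shift]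
  have hR0 : R.eval 0 = ((k : ℚ) + 1) * (k ! : ℚ) ^ 2 / (2 * (k + 2)) := by
    simp [hR, hψ, eval_comp, eval_zero_centralFactorial]
    field_simp
    ring
  have : (derivative (derivative (X ^ 2 * R))).eval 0 = 2 * R.eval 0 := by
    simp [derivative_mul]
    norm_num
  rw [this, hR0, Nat.factorial_succ]
  push_cast
  field_simp

/-! ### Hypergeometric coefficients and their recurrences -/

/-- The coefficients of the monic orthogonal polynomials in the basis `centralFactorial`. -/
def wilsonCoeff (n k : ℕ) : ℚ :=
  if k ≤ n then
    (-1) ^ k * (((n + 1)! : ℚ) ^ 2 * (n ! : ℚ) ^ 2 * ((n + k + 1)! : ℚ)) /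
      (((2 * n + 1)! : ℚ) * ((n - k)! : ℚ) * ((k + 1)! : ℚ) ^ 2 * (k ! : ℚ) ^ 2)
  else 0

def wilsonS (n : ℕ) : ℚ :=
  ((n : ℚ) + 1) ^ 2 * (2 * (n : ℚ) ^ 2 + 4 * n + 1) / ((2 * (n : ℚ) + 1) * (2 * n + 3))

def wilsonT (n : ℕ) : ℚ :=
  (n : ℚ) ^ 3 * ((n : ℚ) + 1) ^ 3 / (4 * (2 * (n : ℚ) + 1) ^ 2)

theorem wilsonCoeff_of_lt {n k : ℕ} (h : n < k) : wilsonCoeff n k = 0 :=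
  if_neg (by omega)

theorem wilsonCoeff_add (k d : ℕ) :
    wilsonCoeff (k + d) k =
      (-1) ^ k * (((k + d + 1)! : ℚ) ^ 2 * ((k + d)! : ℚ) ^ 2 * ((2 * k + d + 1)! : ℚ)) /
      (((2 * k + 2 * d + 1)! : ℚ) * (d ! : ℚ) * ((k + 1)! : ℚ) ^ 2 * (k ! : ℚ) ^ 2) := by
  rw [wilsonCoeff, if_pos (by omega), show k + d - k = d by omega,
    show k + d + k + 1 = 2 * k + d + 1 by omega, show 2 * (k + d) + 1 = 2 * k + 2 * d + 1 by omega]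

theorem wilsonCoeff_self (n : ℕ) : wilsonCoeff n n = (-1) ^ n := by
  have := wilsonCoeff_add n 0
  simp only [add_zero, mul_zero, Nat.factorial_zero, Nat.cast_one, mul_one] at this
  rw [this]
  have h1 : ((2 * n + 1)! : ℚ) ≠ 0 := by positivity
  field_simp

/-- Raising the degree. -/
theorem wilsonCoeff_succ_left (k d : ℕ) :
    wilsonCoeff (k + d + 1) k = wilsonCoeff (k + d) k *
      (((k : ℚ) + d + 2) * (k + d + 1) ^ 2 * (2 * k + d + 2) * (k + d + 2) /
        ((2 * k + 2 * d + 3) * (2 * k + 2 * d + 2) * (d + 1))) := by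
  rw [add_assoc k d 1, wilsonCoeff_add, wilsonCoeff_add,
    show k + (d + 1) + 1 = (k + d + 1) + 1 by omega, show k + (d + 1) = k + d + 1 by omega,
    show 2 * k + (d + 1) + 1 = (2 * k + d + 1) + 1 by omega,
    show 2 * k + 2 * (d + 1) + 1 = (2 * k + 2 * d + 2) + 1 by omega]
  simp only [Nat.factorial_succ (k + d + 1), Nat.factorial_succ (k + d),
    Nat.factorial_succ (2 * k + d + 1), Nat.factorial_succ (2 * k + 2 * d + 2),
    Nat.factorial_succ (2 * k + 2 * d + 1), Nat.factorial_succ d]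
  push_cast
  field_simp
  ring

theorem wilsonCoeff_succ_right (k d : ℕ) :
    wilsonCoeff (k + 1 + d) (k + 1) = wilsonCoeff (k + (d + 1)) k *
      (-((d + 1) * (2 * k + d + 3)) / (((k : ℚ) + 2) ^ 2 * (k + 1) ^ 2)) := by
  rw [wilsonCoeff_add, wilsonCoeff_add,
    show k + (d + 1) + 1 = (k + d + 1) + 1 by omega, show k + (d + 1) = k + d + 1 by omega,
    show k + 1 + d + 1 = (k + d + 1) + 1 by omega, show k + 1 + d = k + d + 1 by omega,
    show 2 * k + (d + 1) + 1 = 2 * k + d + 2 by omega,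
    show 2 * (k + 1) + d + 1 = (2 * k + d + 2) + 1 by omega,
    show 2 * (k + 1) + 2 * d + 1 = 2 * k + 2 * (d + 1) + 1 by omega,
    Nat.factorial_succ (2 * k + d + 2), Nat.factorial_succ d, Nat.factorial_succ (k + 1),
    Nat.factorial_succ k, pow_succ]
  push_cast
  field_simp
  ring

theorem wilsonCoeff_rec_zero (n : ℕ) :
    wilsonCoeff (n + 2) 0 =
      (wilsonS (n + 1) + 1) * wilsonCoeff (n + 1) 0 - wilsonT (n + 1) * wilsonCoeff n 0 := by
  have h1 := wilsonCoeff_succ_left 0 n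
  have h2 := wilsonCoeff_succ_left 0 (n + 1)
  simp only [zero_add, show n + 1 + 1 = n + 2 from rfl] at h1 h2
  rw [h2, h1, wilsonS, wilsonT]
  push_cast
  field_simp
  ring

/-- Compares coefficients of `centralFactorial (k + 1)` in the three-term recurrence, using
`X_mul_centralFactorial`. For k < n all terms are rational multiples of one coefficient; k = n and k
= n + 1 are boundary cases. -/
theorem wilsonCoeff_rec_succ (n k : ℕ) :
    wilsonCoeff (n + 2) (k + 1) =
      (wilsonS (n + 1) + ((k : ℚ) + 2) ^ 2) * wilsonCoeff (n + 1) (k + 1) -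
        wilsonCoeff (n + 1) k - wilsonT (n + 1) * wilsonCoeff n (k + 1) := by
  rcases lt_trichotomy k (n + 1) with h | rfl | h
  · rcases Nat.lt_succ_iff_lt_or_eq.1 h with h | rfl
    · obtain ⟨d, rfl⟩ : ∃ d, n = k + 1 + d := ⟨n - (k + 1), by omega⟩
      have e1 := wilsonCoeff_succ_left (k + 1) d
      have e2 := wilsonCoeff_succ_left (k + 1) (d + 1)
      have e3 := wilsonCoeff_succ_left k (d + 1)
      have e4 := wilsonCoeff_succ_right k d
      rw [← add_assoc (k + 1) d 1, show k + 1 + d + 1 + 1 = k + 1 + d + 2 from rfl] at e2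
      rw [show k + (d + 1) + 1 = k + 1 + d + 1 by omega] at e3
      rw [e2, e1, e3, e4, wilsonS, wilsonT]
      push_cast
      field_simp
      ring
    · have e1 := wilsonCoeff_succ_left (k + 1) 0
      have e3 := wilsonCoeff_succ_right k 0
      rw [add_zero, show k + 1 + 1 = k + 2 from rfl] at e1
      simp only [zero_add, add_zero] at e3
      rw [e1, wilsonCoeff_of_lt (Nat.lt_succ_self k), wilsonCoeff_self, wilsonS]
      rw [wilsonCoeff_self] at e3
      have e4 : wilsonCoeff (k + 1) k =
        (-1) ^ k * (((k : ℚ) + 2) ^ 2 * (k + 1) ^ 2 / (2 * k + 3)) := by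
        push_cast at e3
        rw [pow_succ] at e3
        field_simp at e3 ⊢
        linear_combination e3
      rw [e4, pow_succ]
      push_cast
      field_simp
      ring
  · rw [wilsonCoeff_self, wilsonCoeff_self, wilsonCoeff_of_lt (by omega),
      wilsonCoeff_of_lt (by omega)]
    ring
  · simp [wilsonCoeff_of_lt, show n + 2 < k + 1 by omega, show n + 1 < k + 1 by omega,
      show n < k + 1 by omega, show n + 1 < k by omega]

/-! ### The polynomials orthogonal for (2k+3)B_{2k+2} -/

open Polynomial in
/-- The monic Wilson polynomials orthogonal for the moments
`(2k+3) B_{2k+2}`. -/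
noncomputable def wilsonPoly (n : ℕ) : ℚ[X] :=
  ∑ k ∈ Finset.range (n + 1), C (wilsonCoeff n k) * centralFactorial k

open Polynomial in
theorem wilsonPoly_eq_sum {n N : ℕ} (h : n < N) :
    wilsonPoly n = ∑ k ∈ Finset.range N, C (wilsonCoeff n k) * centralFactorial k := by
  refine Finset.sum_subset (Finset.range_subset_range.2 h) fun k _ hk => ?_
  rw [wilsonCoeff_of_lt (by simpa using hk), C_0, zero_mul]

open Polynomial in
theorem wilsonPoly_zero : wilsonPoly 0 = 1 := by
  simp [wilsonPoly, wilsonCoeff_self, centralFactorial]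

open Polynomial in
theorem wilsonPoly_one : wilsonPoly 1 = X + C (1 / 3) := by
  have h : wilsonCoeff 1 0 = 1 + 1 / 3 := by
    norm_num [wilsonCoeff, Nat.factorial]
  rw [wilsonPoly, Finset.sum_range_succ, Finset.sum_range_one, h, wilsonCoeff_self,
    centralFactorial_succ, C_add, C_1]
  simp [centralFactorial]
  ring

open Polynomial in
theorem X_mul_wilsonPoly (n : ℕ) :
    X * wilsonPoly n =
      ∑ k ∈ Finset.range (n + 2), C (((k : ℚ) + 1) ^ 2 * wilsonCoeff n k) * centralFactorial k -
      ∑ k ∈ Finset.range (n + 1), C (wilsonCoeff n k) * centralFactorial (k + 1) := by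
  rw [Finset.sum_range_succ _ (n + 1), wilsonCoeff_of_lt (Nat.lt_succ_self n), mul_zero, C_0,
    zero_mul, add_zero, ← Finset.sum_sub_distrib, wilsonPoly, Finset.mul_sum]
  refine Finset.sum_congr rfl fun k _ => ?_
  rw [C_mul]
  linear_combination C (wilsonCoeff n k) * X_mul_centralFactorial k

open Polynomial in
theorem wilsonPoly_three_term (n : ℕ) :
    wilsonPoly (n + 2) =
      (X + C (wilsonS (n + 1))) * wilsonPoly (n + 1) - C (wilsonT (n + 1)) * wilsonPoly n := by
  rw [add_mul, X_mul_wilsonPoly, wilsonPoly_eq_sum (show n + 2 < n + 3 by omega),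
    wilsonPoly_eq_sum (show n + 1 < n + 3 by omega), wilsonPoly_eq_sum (show n < n + 3 by omega)]
  -- The index 0 is split off: the shifted sum contributes nothing there.
  simp only [show n + 1 + 2 = n + 2 + 1 from rfl,
    Finset.sum_range_succ' _ (n + 2), mul_add, Finset.mul_sum]
  have key : ∀ k, C (wilsonCoeff (n + 2) (k + 1)) * centralFactorial (k + 1) =
      C ((((k + 1 : ℕ) : ℚ) + 1) ^ 2 * wilsonCoeff (n + 1) (k + 1)) * centralFactorial (k + 1) -
      C (wilsonCoeff (n + 1) k) * centralFactorial (k + 1) +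
      C (wilsonS (n + 1)) * (C (wilsonCoeff (n + 1) (k + 1)) * centralFactorial (k + 1)) -
      C (wilsonT (n + 1)) * (C (wilsonCoeff n (k + 1)) * centralFactorial (k + 1)) := by
    intro k
    rw [wilsonCoeff_rec_succ, Nat.cast_succ]
    simp only [C_sub, C_mul, C_add, C_pow, C_1]
    have : (C (2 : ℚ) : ℚ[X]) = 1 + 1 := by rw [← C_1, ← C_add]; norm_num
    rw [this]
    ring
  simp only [key, Finset.sum_add_distrib, Finset.sum_sub_distrib]
  rw [wilsonCoeff_rec_zero]
  simp only [C_sub, C_mul, C_add, C_pow, C_1, Nat.cast_zero, zero_add, one_pow, one_mul]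
  ring

/-- The Chu–Vandermonde partial sums. -/
theorem sum_wilsonCoeff_mul_moment (n m : ℕ) (hm : m ≤ n) :
    ∑ k ∈ Finset.range (m + 1), wilsonCoeff (n + 1) k * ((k ! : ℚ) * ((k + 1)! : ℚ) / (k + 2)) =
      wilsonCoeff (n + 1) m * ((m ! : ℚ) * ((m + 1)! : ℚ) / (m + 2)) *
        (((n : ℚ) + 1 - m) * (n + 3 + m) / ((n + 1) * (n + 3))) := by
  induction m with
  | zero => simp; field_simp
  | succ m ih =>
    rw [Finset.sum_range_succ, ih (by omega)]
    obtain ⟨d, rfl⟩ : ∃ d, n = m + 1 + d := ⟨n - (m + 1), by omega⟩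
    have h := wilsonCoeff_succ_right m (d + 1)
    rw [show m + 1 + (d + 1) = m + 1 + d + 1 by omega,
      show m + (d + 1 + 1) = m + 1 + d + 1 by omega] at h
    rw [h, Nat.factorial_succ (m + 1), Nat.factorial_succ m]
    push_cast
    field_simp
    ring

theorem momentFunctional_wilsonPoly_succ (n : ℕ) :
    momentFunctional (fun k : ℕ => (2 * (k : ℚ) + 3) * bernoulli (2 * k + 2)) (wilsonPoly (n + 1)) =
      0 := by
  rw [wilsonPoly, map_sum]
  simp only [momentFunctional_C_mul, momentFunctional_centralFactorial]
  -- The last term, of index n + 1, cancels the partial sum up to n.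
  rw [Finset.sum_range_succ, sum_wilsonCoeff_mul_moment n n le_rfl]
  have h := wilsonCoeff_succ_right n 0
  simp only [add_zero, zero_add] at h
  rw [h, Nat.factorial_succ (n + 1), Nat.factorial_succ n]
  push_cast
  field_simp
  ring

theorem wilsonT_succ_ne_zero (n : ℕ) : wilsonT (n + 1) ≠ 0 := by
  rw [wilsonT]; positivity

theorem wilsonPoly_monic (n : ℕ) : (wilsonPoly n).Monic :=
  (monic_natDegree_of_three_term (s := wilsonS) wilsonPoly_zero
    (by rw [wilsonPoly_one, wilsonS]; norm_num) wilsonPoly_three_term n).1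

theorem wilsonPoly_natDegree (n : ℕ) : (wilsonPoly n).natDegree = n :=
  (monic_natDegree_of_three_term (s := wilsonS) wilsonPoly_zero
    (by rw [wilsonPoly_one, wilsonS]; norm_num) wilsonPoly_three_term n).2

/-- The squared norms of the polynomials `wilsonPoly`. -/
noncomputable def wilsonNorm (n : ℕ) : ℚ :=
  momentFunctional (fun k : ℕ => (2 * (k : ℚ) + 3) * bernoulli (2 * k + 2))
    (Polynomial.X ^ n * wilsonPoly n)

theorem wilsonPoly_orthogonal (n j : ℕ) (h : j < n) :
    momentFunctional (fun k : ℕ => (2 * (k : ℚ) + 3) * bernoulli (2 * k + 2))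
      (Polynomial.X ^ j * wilsonPoly n) = 0 :=
  (momentFunctional_three_term wilsonPoly_three_term momentFunctional_wilsonPoly_succ j).1 n h

theorem wilsonNorm_succ (n : ℕ) : wilsonNorm (n + 1) = wilsonT (n + 1) * wilsonNorm n :=
  (momentFunctional_three_term wilsonPoly_three_term momentFunctional_wilsonPoly_succ n).2

theorem wilsonNorm_zero : wilsonNorm 0 = 1 / 2 := by
  rw [wilsonNorm, wilsonPoly_zero, mul_one, momentFunctional_X_pow]
  norm_num [bernoulli_two]

theorem wilsonNorm_ne_zero (n : ℕ) : wilsonNorm n ≠ 0 := by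
  induction n with
  | zero => rw [wilsonNorm_zero]; norm_num
  | succ n ih => rw [wilsonNorm_succ]; exact mul_ne_zero (wilsonT_succ_ne_zero n) ih

theorem wilsonPoly_isMonicOrthogonal :
    IsMonicOrthogonal (fun k : ℕ => (2 * (k : ℚ) + 3) * bernoulli (2 * k + 2)) wilsonPoly :=
  .of_orthogonal_X_pow wilsonPoly_monic wilsonPoly_natDegree wilsonPoly_orthogonal
    wilsonNorm_ne_zero

theorem hankelDet_shifted_bernoulli (n : ℕ) :
    hankelDet (fun k : ℕ => (2 * (k : ℚ) + 3) * bernoulli (2 * k + 2)) n =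
      ∏ k ∈ Finset.range (n + 1), wilsonNorm k :=
  hankelDet_eq_prod _ wilsonPoly wilsonPoly_monic wilsonPoly_natDegree wilsonPoly_orthogonal n

/-! ### Geronimus transform to the moments (2k+1)B_{2k} -/

open Polynomial in
theorem momentFunctional_X_mul_eq_shift (f : ℚ[X]) :
    momentFunctional (fun k : ℕ => (2 * (k : ℚ) + 1) * _root_.bernoulli (2 * k)) (X * f) =
      momentFunctional (fun k : ℕ => (2 * (k : ℚ) + 3) * _root_.bernoulli (2 * k + 2)) f := by
  induction f using Polynomial.induction_on' with
  | add p q hp hq => rw [mul_add, map_add, map_add, hp, hq]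
  | monomial n a =>
    rw [← C_mul_X_pow_eq_monomial, mul_left_comm, ← pow_succ', momentFunctional_C_mul,
      momentFunctional_C_mul, momentFunctional_X_pow, momentFunctional_X_pow]
    push_cast
    rw [show 2 * (n + 1) = 2 * n + 2 by ring]
    ring

/-- The value of the functional with moments `(2k+1) B_{2k}` at `wilsonPoly n`. -/
noncomputable def wilsonMass (n : ℕ) : ℚ :=
  momentFunctional (fun k : ℕ => (2 * (k : ℚ) + 1) * bernoulli (2 * k)) (wilsonPoly n)

theorem wilsonMass_zero : wilsonMass 0 = 1 := by
  rw [wilsonMass, wilsonPoly_zero, ← pow_zero Polynomial.X, momentFunctional_X_pow]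
  simp

theorem wilsonMass_one : wilsonMass 1 = 5 / 6 := by
  rw [wilsonMass, wilsonPoly_one, map_add, ← pow_one Polynomial.X, momentFunctional_X_pow,
    ← mul_one (Polynomial.C _), momentFunctional_C_mul, ← pow_zero Polynomial.X,
    momentFunctional_X_pow]
  norm_num [bernoulli_two]

-- Applying M to the three-term recurrence, the term y P_{n+1} contributes L(P_{n+1}) = 0.
open Polynomial in
theorem wilsonMass_rec (n : ℕ) :
    wilsonMass (n + 2) = wilsonS (n + 1) * wilsonMass (n + 1) - wilsonT (n + 1) * wilsonMass n := by
  rw [wilsonMass, wilsonPoly_three_term, add_mul, map_sub, map_add, momentFunctional_C_mul,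
    momentFunctional_C_mul, momentFunctional_X_mul_eq_shift, momentFunctional_wilsonPoly_succ,
    zero_add]
  rfl

/-- The ratio `(2n+2)! / (n! (n+1)!³)` times the squared norm of `wilsonPoly n`. -/
noncomputable def wilsonScale (n : ℕ) : ℚ :=
  ((2 * n + 2)! : ℚ) / ((n ! : ℚ) * ((n + 1)! : ℚ) ^ 3) * wilsonNorm n

theorem wilsonScale_zero : wilsonScale 0 = 1 := by
  rw [wilsonScale, wilsonNorm_zero]
  norm_num [Nat.factorial]

theorem wilsonScale_succ (n : ℕ) :
    wilsonScale (n + 1) = wilsonScale n * (((n : ℚ) + 2) * (n + 1) ^ 2 / (2 * (2 * n + 3))) := by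
  rw [wilsonScale, wilsonScale, wilsonNorm_succ, wilsonT,
    show 2 * (n + 1) + 2 = (2 * n + 3) + 1 by ring, Nat.factorial_succ (2 * n + 3),
    Nat.factorial_succ (2 * n + 2), Nat.factorial_succ (n + 1), Nat.factorial_succ n]
  push_cast
  field_simp
  ring

theorem wilsonMass_eq (n : ℕ) :
    wilsonMass n = wilsonScale n * (harmonic n + harmonic (n + 1)) := by
  induction n using Nat.twoStepInduction with
  | zero => simp [wilsonMass_zero, wilsonScale_zero]
  | one =>
    have h := wilsonScale_succ 0
    rw [wilsonScale_zero] at h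
    rw [wilsonMass_one, h]
    norm_num [harmonic_succ]
  | more n ih0 ih1 =>
    rw [wilsonMass_rec, ih0, ih1, wilsonScale_succ (n + 1), wilsonScale_succ n,
      harmonic_succ (n + 2), harmonic_succ (n + 1), harmonic_succ n, wilsonS, wilsonT]
    push_cast
    field_simp
    ring

theorem wilsonMass_ne_zero (n : ℕ) : wilsonMass n ≠ 0 := by
  rw [wilsonMass_eq, wilsonScale]
  have h0 : 0 ≤ harmonic n := Finset.sum_nonneg fun i _ => by positivity
  have h1 : 0 < harmonic (n + 1) := harmonic_pos (Nat.succ_ne_zero n)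
  have h2 := wilsonNorm_ne_zero n
  have h3 : harmonic n + harmonic (n + 1) ≠ 0 := by positivity
  positivity

open Polynomial in
/-- The Geronimus transform of `wilsonPoly`, orthogonal for the moments `(2k+1) B_{2k}`. -/
noncomputable def geronimusPoly : ℕ → ℚ[X]
  | 0 => 1
  | n + 1 => wilsonPoly (n + 1) - C (wilsonMass (n + 1) / wilsonMass n) * wilsonPoly n

open Polynomial in
theorem geronimusPoly_monic_natDegree (n : ℕ) :
    (geronimusPoly n).Monic ∧ (geronimusPoly n).natDegree = n := by
  rcases n with _ | n
  · simp [geronimusPoly]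
  · have hlt : (C (wilsonMass (n + 1) / wilsonMass n) * wilsonPoly n).natDegree <
        (wilsonPoly (n + 1)).natDegree :=
      lt_of_le_of_lt (natDegree_C_mul_le _ _)
        (by rw [wilsonPoly_natDegree, wilsonPoly_natDegree]; omega)
    constructor
    · exact (wilsonPoly_monic _).sub_of_left (degree_lt_degree hlt)
    · rw [geronimusPoly, natDegree_sub_eq_left_of_natDegree_lt hlt, wilsonPoly_natDegree]

open Polynomial in
theorem momentFunctional_X_pow_succ_mul_geronimusPoly (j n : ℕ) :
    momentFunctional (fun k : ℕ => (2 * (k : ℚ) + 1) * _root_.bernoulli (2 * k))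
        (X ^ (j + 1) * geronimusPoly (n + 1)) =
      momentFunctional (fun k : ℕ => (2 * (k : ℚ) + 3) * _root_.bernoulli (2 * k + 2))
        (X ^ j * wilsonPoly (n + 1)) - wilsonMass (n + 1) / wilsonMass n *
      momentFunctional (fun k : ℕ => (2 * (k : ℚ) + 3) * _root_.bernoulli (2 * k + 2))
        (X ^ j * wilsonPoly n) := by
  rw [pow_succ', mul_assoc, momentFunctional_X_mul_eq_shift, geronimusPoly, mul_sub, map_sub,
    mul_left_comm, momentFunctional_C_mul]

/-- The coefficient μ_{n+1}/μ_n is exactly what kills the case j = 0; for j > 0 one power of y turns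
M into L. -/
theorem geronimusPoly_orthogonal (n j : ℕ) (h : j < n) :
    momentFunctional (fun k : ℕ => (2 * (k : ℚ) + 1) * bernoulli (2 * k))
      (Polynomial.X ^ j * geronimusPoly n) = 0 := by
  obtain ⟨n, rfl⟩ : ∃ m, n = m + 1 := ⟨n - 1, by omega⟩
  rcases j with _ | j
  · rw [pow_zero, one_mul, geronimusPoly, map_sub, momentFunctional_C_mul]
    change wilsonMass (n + 1) - wilsonMass (n + 1) / wilsonMass n * wilsonMass n = 0
    rw [div_mul_cancel₀ _ (wilsonMass_ne_zero n), sub_self]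
  · rw [momentFunctional_X_pow_succ_mul_geronimusPoly, wilsonPoly_orthogonal _ _ (by omega),
      wilsonPoly_orthogonal _ _ (by omega), mul_zero, sub_zero]

theorem geronimusPoly_norm_succ (n : ℕ) :
    momentFunctional (fun k : ℕ => (2 * (k : ℚ) + 1) * bernoulli (2 * k))
        (Polynomial.X ^ (n + 1) * geronimusPoly (n + 1)) =
      -(wilsonMass (n + 1) / wilsonMass n * wilsonNorm n) := by
  rw [momentFunctional_X_pow_succ_mul_geronimusPoly, wilsonPoly_orthogonal _ _ (by omega),
    zero_sub, wilsonNorm]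

theorem hankelDet_even_bernoulli (n : ℕ) :
    hankelDet (fun k : ℕ => (2 * (k : ℚ) + 1) * bernoulli (2 * k)) n =
      (-1) ^ n * wilsonMass n * ∏ k ∈ Finset.range n, wilsonNorm k := by
  rw [hankelDet_eq_prod _ geronimusPoly (fun n => (geronimusPoly_monic_natDegree n).1)
    (fun n => (geronimusPoly_monic_natDegree n).2) geronimusPoly_orthogonal]
  induction n with
  | zero =>
    rw [Finset.prod_range_one, geronimusPoly, mul_one, momentFunctional_X_pow, wilsonMass_zero]
    simp
  | succ n ih =>
    have := wilsonMass_ne_zero n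
    rw [Finset.prod_range_succ, ih, geronimusPoly_norm_succ, Finset.prod_range_succ]
    field_simp
    ring

theorem proposition6p2 :
    (∀ n : ℕ,
      hankelDet (fun k : ℕ => (2 * (k : ℚ) + 1) * bernoulli (2 * k)) n =
        (-1 : ℚ) ^ n * ((2 * n + 2)! : ℚ) / ((n ! : ℚ) * ((n + 1)! : ℚ) ^ 3) *
          (harmonic n + harmonic (n + 1)) *
          hankelDet (fun k : ℕ => (2 * (k : ℚ) + 3) * bernoulli (2 * k + 2)) n) ∧
    (∃! P : ℕ → Polynomial ℚ,
      IsMonicOrthogonal (fun k : ℕ => (2 * (k : ℚ) + 3) * bernoulli (2 * k + 2)) P) ∧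
    (∀ P : ℕ → Polynomial ℚ,
      IsMonicOrthogonal (fun k : ℕ => (2 * (k : ℚ) + 3) * bernoulli (2 * k + 2)) P →
        P 0 = 1 ∧
        P 1 = Polynomial.X + Polynomial.C (1 / 3 : ℚ) ∧
        ∀ n : ℕ, 1 ≤ n →
          P (n + 1) =
            (Polynomial.X +
              Polynomial.C (((n : ℚ) + 1) ^ 2 * (2 * (n : ℚ) ^ 2 + 4 * n + 1) /
                ((2 * (n : ℚ) + 1) * (2 * n + 3)))) * P n -
            Polynomial.C ((n : ℚ) ^ 3 * ((n : ℚ) + 1) ^ 3 / (4 * (2 * (n : ℚ) + 1) ^ 2)) *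
              P (n - 1)) := by
  have huniq : ∀ P : ℕ → Polynomial ℚ,
      IsMonicOrthogonal (fun k : ℕ => (2 * (k : ℚ) + 3) * bernoulli (2 * k + 2)) P →
        P = wilsonPoly := fun P hP =>
    hP.eq_of_orthogonal_X_pow wilsonPoly_isMonicOrthogonal wilsonPoly_orthogonal wilsonNorm_ne_zero
  refine ⟨fun n => ?_, ⟨wilsonPoly, wilsonPoly_isMonicOrthogonal, huniq⟩, fun P hP => ?_⟩
  · rw [hankelDet_even_bernoulli, hankelDet_shifted_bernoulli, wilsonMass_eq, wilsonScale,
      Finset.prod_range_succ]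
    ring
  · rw [huniq P hP]
    refine ⟨wilsonPoly_zero, wilsonPoly_one, fun n hn => ?_⟩
    obtain ⟨m, rfl⟩ : ∃ m, n = m + 1 := ⟨n - 1, by omega⟩
    exact wilsonPoly_three_term m
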